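/- \textbf{Setting.} Let $N\ge 2$ and let $\mathscr G$ be a signed digraph without self-loops on the nodes $\{1,\dots,N\}$, with real weighted adjacency matrix $(w_{kl})$; there is an edge from $l$ to $k$ iff $w_{kl}\neq 0$, and $\mathcal N_k=\{l: w_{kl}\ne 0\}$. $\mathscr G$ is weakly connected if it becomes a connected graph when edge directions are forgotten. A closed strong component (CSC) is a maximal strongly connected subgraph with no incoming edge from a node outside it. A signed digraph is structurally balanced if its nodes can be split into two disjoint (possibly empty) parts such that $w_{kl}\ge 0$ for $k,l$ in the same part and $w_{kl}\le 0$ for $k,l$ in different parts; otherwise it is structurally unbalanced. The nodes of the CSCs are the leaders (set $\mathcal L$), the other nodes are the followers. The Laplacian of a signed digraph is $\mathrm{diag}(\sum_{l\in\mathcal N_k}|w_{kl}|)_k-(w_{kl})$; write $\mathscr L_C$ for the Laplacian of a CSC $C$. Let $\rho_1,\rho_2,\kappa,T_1>0$. Put $\varphi(t)=T_1^\kappa/(T_1-t)^\kappa$ and $\dot\varphi(t)=\frac{\kappa}{T_1}\varphi(t)^{1+1/\kappa}$ for $0\le t<T_1$, and $\varphi(t)=1$, $\dot\varphi(t)=0$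 for $t\ge T_1$. The nominal network under the protocol is $$\dot x_k=\Big(\rho_1+\rho_2\frac{\dot\varphi(t)}{\varphi(t)}\Big)\sum_{l\in\mathcal N_k}w_{kl}\big[x_l-\operatorname{sign}(w_{kl})x_k\big],\qquad k=1,\dots,N .$$ A trajectory is a continuous $x:[0,\infty)\to\mathbb R^N$ that satisfies these equations on $[0,T_1)$ and on $[T_1,\infty)$ (with the right-hand derivative at $T_1$). \textbf{Theorem 3.} Let $\mathscr G$ be weakly connected. (1) If at least one CSC of $\mathscr G$ is structurally balanced, then the network achieves prescribed-time bipartite containment at time $T_1$: from every initial state there is a trajectory, and every trajectory satisfies: (a) for each structurally balanced CSC $C$ there is $x^*_C\ge 0$ such that $\lim_{t\to T_1}|x_k(t)|=x^*_C$ and $|x_k(t)|=x^*_C$ for all $t\ge T_1$, for every $k\in C$; moreover $x^*_C>0$ if and only if the vector $(x_k(0))_{k\in C}$ is not in the range of $\mathscr L_C$, and this range is a proper subspace of $\mathbb R^C$; (b) for each structurally unbalanced CSC $C$ and each $k\in C$, $\lim_{t\to T_1}x_k(t)=0$ and $x_k(t)=0$ for all $t\ge T_1$; (c) for each follower $l$,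 the limit $\lim_{t\to T_1}\big[\max_{k\in\mathcal L}|x_k(t)|-|x_l(t)|\big]$ exists and is $\ge 0$, and $x_l(t)\in\big[-\max_{k\in\mathcal L}|x_k(t)|,\ \max_{k\in\mathcal L}|x_k(t)|\big]$ for all $t\ge T_1$. (2) If all CSCs of $\mathscr G$ are structurally unbalanced, then the network achieves prescribed-time stability at time $T_1$: from every initial state there is a trajectory, and every trajectory satisfies $\lim_{t\to T_1}x_k(t)=0$ and $x_k(t)=0$ for all $t\ge T_1$ and all $k$. -/

import Mathlib

open Filter Topology

/-- A signed digraph on the node set `V`, given by its weighted adjacency matrix: there is an edge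
from `l` to `k` iff `w k l ≠ 0`. There are no self-loops. -/
structure SignedDigraph (V : Type*) where
  /-- The weighted adjacency matrix. -/
  w : Matrix V V ℝ
  no_loop : ∀ k, w k k = 0

namespace SignedDigraph

/-- `G.Edge l k`: there is an edge from `l` to `k`. -/
def Edge {V : Type*} (G : SignedDigraph V) (l k : V) : Prop := G.w k l ≠ 0

/-- `G.Path k l`: `l` is reached from `k` along directed edges. -/
def Path {V : Type*} (G : SignedDigraph V) (k l : V) : Prop := Relation.ReflTransGen G.Edge k l

/-- There is a directed path between every two nodes (in both directions). -/
def StronglyConnected {V : Type*} (G : SignedDigraph V) : Prop := ∀ k l, G.Path k l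

/-- The undirected graph obtained by forgetting the directions of the edges is connected. -/
def WeaklyConnected {V : Type*} (G : SignedDigraph V) : Prop := (SimpleGraph.fromRel G.Edge).Connected

/-- There is a bipartition of the nodes (one part may be empty) with nonnegative weights inside the
parts and nonpositive weights between them. -/
def StructurallyBalanced {V : Type*} (G : SignedDigraph V) : Prop :=
  ∃ V₁ V₂ : Set V, V₁ ∩ V₂ = ∅ ∧ V₁ ∪ V₂ = Set.univ ∧
    (∀ k ∈ V₁, ∀ l ∈ V₁, 0 ≤ G.w k l) ∧ (∀ k ∈ V₂, ∀ l ∈ V₂, 0 ≤ G.w k l) ∧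
    (∀ k ∈ V₁, ∀ l ∈ V₂, G.w k l ≤ 0) ∧ (∀ k ∈ V₂, ∀ l ∈ V₁, G.w k l ≤ 0)

/-- The subgraph of all edges between nodes of `C`. -/
def induce {V : Type*} (G : SignedDigraph V) (C : Finset V) : SignedDigraph C where
  w := fun k l => G.w k l
  no_loop := fun k => G.no_loop k

/-- `C` is the node set of a closed strong component: a maximal strongly connected subgraph with no
incoming edge from a node outside. -/
structure IsClosedStrongComponent {V : Type*} (G : SignedDigraph V) (C : Finset V) : Prop where
  nonempty : C.Nonempty
  stronglyConnected : (G.induce C).StronglyConnected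
  maximal : ∀ C' : Finset V, C ⊆ C' → (G.induce C').StronglyConnected → C' = C
  closed : ∀ k ∈ C, ∀ l ∉ C, ¬ G.Edge l k

/-- A leader is a node of some closed strong component; the other nodes are followers. -/
def IsLeader {V : Type*} (G : SignedDigraph V) (k : V) : Prop :=
  ∃ C : Finset V, G.IsClosedStrongComponent C ∧ k ∈ C

/-- The in-neighbours of `k`. -/
noncomputable def inNeighbors {V : Type*} [Fintype V] (G : SignedDigraph V) (k : V) : Finset V :=
  Finset.univ.filter (fun l => G.w k l ≠ 0)

/-- The Laplacian matrix of a signed digraph. -/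
noncomputable def laplacian {V : Type*} [Fintype V] [DecidableEq V] (G : SignedDigraph V) :
    Matrix V V ℝ :=
  Matrix.diagonal (fun k => ∑ l ∈ G.inNeighbors k, |G.w k l|) - G.w

end SignedDigraph

/-- The time-varying function `φ(t, T)` with exponent `κ`. -/
noncomputable def phi (κ T t : ℝ) : ℝ :=
  if t < T then T ^ κ / (T - t) ^ κ else 1

/-- The derivative `φ̇(t, T)` (the right-hand one at `t = T`). -/
noncomputable def phiDot (κ T t : ℝ) : ℝ :=
  if t < T then κ / T * phi κ T t ^ (1 + 1 / κ) else 0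

namespace SignedDigraph

/-- The control input of agent `k` at time `t`, in the network state `y`. -/
noncomputable def control {V : Type*} [Fintype V] (G : SignedDigraph V) (ρ₁ ρ₂ κ T : ℝ)
    (t : ℝ) (y : V → ℝ) (k : V) : ℝ :=
  (ρ₁ + ρ₂ * (phiDot κ T t / phi κ T t)) *
    ∑ l ∈ G.inNeighbors k, G.w k l * (y l - Real.sign (G.w k l) * y k)

/-- `x : [0, ∞) → ℝ^V` is a trajectory of the nominal network `ẋ_k = u_k` under the protocol: it is
continuous and satisfies the equation on `[0, T)` and on `[T, ∞)` (with the right-hand derivative at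
the switching time `T`, where the gain jumps). -/
structure IsTrajectory {V : Type*} [Fintype V] (G : SignedDigraph V) (ρ₁ ρ₂ κ T : ℝ)
    (x : ℝ → V → ℝ) : Prop where
  continuousOn : ContinuousOn x (Set.Ici 0)
  before : ∀ t ∈ Set.Ico 0 T, ∀ k,
    HasDerivWithinAt (fun s => x s k) (G.control ρ₁ ρ₂ κ T t (x t) k) (Set.Ici 0) t
  after : ∀ t ∈ Set.Ici T, ∀ k,
    HasDerivWithinAt (fun s => x s k) (G.control ρ₁ ρ₂ κ T t (x t) k) (Set.Ici T) t

/-- The nominal network under the protocol achieves the property `P`: from every initial state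
there is a trajectory on `[0, ∞)`, and every trajectory has the property `P`. -/
def Achieves {V : Type*} [Fintype V] (G : SignedDigraph V) (ρ₁ ρ₂ κ T : ℝ)
    (P : (ℝ → V → ℝ) → Prop) : Prop :=
  (∀ x₀ : V → ℝ, ∃ x, G.IsTrajectory ρ₁ ρ₂ κ T x ∧ x 0 = x₀) ∧
    ∀ x, G.IsTrajectory ρ₁ ρ₂ κ T x → P x

end SignedDigraph

/-- The agents in `S` reach stability in the prescribed time `T`. -/
def PrescribedTimeStability {V : Type*} (S : Set V) (T : ℝ) (x : ℝ → V → ℝ) : Prop :=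
  ∀ k ∈ S, Tendsto (fun t => x t k) (𝓝 T) (𝓝 0) ∧ ∀ t ≥ T, x t k = 0

/-- The agents in `S` reach bipartite consensus, with common modulus `xs`, in the prescribed
time `T`. -/
def PrescribedTimeBipartiteConsensus {V : Type*} (S : Set V) (T : ℝ) (x : ℝ → V → ℝ)
    (xs : ℝ) : Prop :=
  ∀ k ∈ S, Tendsto (fun t => |x t k|) (𝓝 T) (𝓝 xs) ∧ ∀ t ≥ T, |x t k| = xs

namespace SignedDigraph

/-- The maximum of the moduli of the states of the leaders, in the network state `y`. -/
noncomputable def leaderMax {V : Type*} (G : SignedDigraph V) (y : V → ℝ) : ℝ :=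
  ⨆ k : {k // G.IsLeader k}, |y k|

/-- Bipartite containment in the prescribed time `T`: the leaders in each structurally balanced
closed strong component `C` reach bipartite consensus, the common modulus being positive except
when the initial states of `C` lie in the range of the Laplacian of `C`, which is a proper subspace;
the leaders in each structurally unbalanced one reach stability; the followers reach the symmetric
hull of the states of the leaders. -/
structure PrescribedTimeBipartiteContainment {V : Type*} [Fintype V] [DecidableEq V]
    (G : SignedDigraph V) (T : ℝ) (x : ℝ → V → ℝ) : Prop where
  balanced : ∀ C : Finset V, G.IsClosedStrongComponent C → (G.induce C).StructurallyBalanced →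
    LinearMap.range (G.induce C).laplacian.mulVecLin ≠ ⊤ ∧
    ∃ xs : ℝ, 0 ≤ xs ∧ PrescribedTimeBipartiteConsensus (C : Set V) T x xs ∧
      (0 < xs ↔
        (fun k : C => x 0 k) ∉ LinearMap.range (G.induce C).laplacian.mulVecLin)
  unbalanced : ∀ C : Finset V, G.IsClosedStrongComponent C →
    ¬ (G.induce C).StructurallyBalanced → PrescribedTimeStability (C : Set V) T x
  followers : ∀ l : V, ¬ G.IsLeader l →
    (∃ d : ℝ, 0 ≤ d ∧ Tendsto (fun t => G.leaderMax (x t) - |x t l|) (𝓝 T) (𝓝 d)) ∧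
    ∀ t ≥ T, x t l ∈ Set.Icc (-G.leaderMax (x t)) (G.leaderMax (x t))

end SignedDigraph

/-!
Write `L` for the Laplacian. In vector form the network is `ẋ = -a(t) L x` with a gain `a` that equals
`ρ₁ + ρ₂ κ / (T - t)` before `T` and `ρ₁` afterwards. In terms of the intrinsic time `∫ a`, which
tends to infinity as `t → T`, a trajectory on `[0, T)` is an entire orbit of the semigroup
`exp (-s L)`. Everything therefore rests on the limit of this semigroup as `s → ∞`.

In the supremum norm, diagonal dominance of `L` says `‖c - L‖ ≤ c` for large `c`, so that
`Q = 1 - c⁻¹ L` is a contraction. Expanding `(1 - Q) exp (τ (Q - 1))` in powers of `Q` gives Poisson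
weights times `1 - n / τ`; since the Poisson distribution of mean `τ` has standard deviation `√τ`, the
norm is at most `1 / √τ` (`norm_one_sub_mul_exp_le`). Hence `exp (-s L)` tends to zero on the range of
`L`, whereas it fixes the kernel pointwise. The kernel and the range are therefore complementary
(`exists_ker_sub_mem_range`), and every trajectory with `x 0 = z + L u`, `L z = 0`, reaches `z` at time
`T` and rests there (`SignedDigraph.IsTrajectory.eq_of_ge`). No spectral theory is needed.

The remaining assertions concern vectors `z` of the kernel. At a node of maximal modulus,
`∑ l, (|w k l| z k - w k l z l) = 0` has summands of one sign, which all vanish: the modulus is also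
maximal at all in-neighbours, and the edges prescribe the signs
(`SignedDigraph.mul_eq_of_laplacianCLM_eq_zero`). So the modulus is constant on a closed strong
component, on which `z` is itself in the kernel of the Laplacian of the component; if it is not zero,
the signs of `z` balance the component. Since every node is reached from a closed strong component, the
maximal modulus is attained at a leader. Finally, the decomposition of `x 0` restricts to the
decomposition for the Laplacian of the component, so the limit vanishes on the component exactly if the
initial states of the component lie in the range of its Laplacian.
-/

/-! ### Poisson weights and the decay of the exponential of a contraction -/

theorem HasSum.of_nat_succ {M : Type*} [NormedAddCommGroup M] {f : ℕ → M} {a : M}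
    (h : HasSum (fun n => f (n + 1)) a) (h0 : f 0 = 0) : HasSum f a := by
  simpa [h0] using (hasSum_nat_add_iff 1).1 h

open NormedSpace in
/-- The Poisson distribution with mean `τ` has variance `τ`; here the counts are divided by `τ` and
the weights are not normalized. -/
theorem hasSum_poisson_variance {τ : ℝ} (hτ : 0 < τ) :
    HasSum (fun n : ℕ => τ ^ n / n.factorial * (1 - n / τ) ^ 2) (Real.exp τ / τ) := by
  have h0 : HasSum (fun n : ℕ => τ ^ n / n.factorial) (Real.exp τ) := by
    rw [Real.exp_eq_exp_ℝ]
    exact expSeries_div_hasSum_exp τ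
  -- the factorial moments, each of which is a shift of the exponential series
  have h1 : HasSum (fun n : ℕ => n * (τ ^ n / n.factorial)) (τ * Real.exp τ) := by
    refine HasSum.of_nat_succ ((h0.mul_left τ).congr_fun fun n => ?_) (by simp)
    rw [Nat.factorial_succ]
    push_cast
    field_simp
    ring
  have h2 : HasSum (fun n : ℕ => n * (n - 1) * (τ ^ n / n.factorial)) (τ ^ 2 * Real.exp τ) := by
    refine HasSum.of_nat_succ (HasSum.of_nat_succ
      ((h0.mul_left (τ ^ 2)).congr_fun fun n => ?_) (by simp)) (by simp)
    rw [Nat.factorial_succ, Nat.factorial_succ]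
    push_cast
    field_simp
    ring
  convert (h0.add (h1.mul_left (1 / τ ^ 2 - 2 / τ))).add (h2.mul_left (1 / τ ^ 2)) using 1
  · ext n
    field_simp
    ring
  · field_simp
    ring

section Banach
variable {𝔸 : Type*} [NormedRing 𝔸] [NormedAlgebra ℝ 𝔸] [CompleteSpace 𝔸]

theorem exp_add_smul (a b : ℝ) (B : 𝔸) :
    NormedSpace.exp ((a + b) • B) = NormedSpace.exp (a • B) * NormedSpace.exp (b • B) := by
  let _ : NormedAlgebra ℚ 𝔸 := NormedAlgebra.restrictScalars ℚ ℝ 𝔸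
  rw [add_smul]
  exact NormedSpace.exp_add_of_commute (((Commute.refl B).smul_left a).smul_right b)

theorem exp_smul_sub_one (τ : ℝ) (Q : 𝔸) :
    NormedSpace.exp (τ • (Q - 1)) = Real.exp (-τ) • NormedSpace.exp (τ • Q) := by
  let _ : NormedAlgebra ℚ 𝔸 := NormedAlgebra.restrictScalars ℚ ℝ 𝔸
  have h : τ • (Q - 1) = algebraMap ℝ 𝔸 (-τ) + τ • Q := by
    rw [Algebra.algebraMap_eq_smul_one, smul_sub, neg_smul]
    abel
  rw [h, NormedSpace.exp_add_of_commute (Algebra.commutes _ _), ← NormedSpace.algebraMap_exp_comm,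
    ← Real.exp_eq_exp_ℝ, ← Algebra.smul_def]

open NormedSpace in
/-- The series of `(1 - Q) exp (τ Q)` has the coefficients `(1 - n / τ) τ ^ n / n!`, so that the norm
is at most the mean absolute deviation of the Poisson distribution, divided by its mean. -/
theorem norm_one_sub_mul_exp_le {Q : 𝔸} (hQ : ∀ n : ℕ, ‖Q ^ n‖ ≤ 1) {τ : ℝ} (hτ : 0 < τ) :
    ‖(1 - Q) * exp (τ • (Q - 1))‖ ≤ 1 / √τ := by
  have h0 : HasSum (fun n : ℕ => (τ ^ n / n.factorial) • Q ^ n) (exp (τ • Q)) := by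
    convert exp_series_hasSum_exp' (𝕂 := ℝ) (τ • Q) using 2 with n
    rw [smul_pow, smul_smul]
    congr 1
    ring
  have h1 : HasSum (fun n : ℕ => (n / τ * (τ ^ n / n.factorial)) • Q ^ n) (Q * exp (τ • Q)) := by
    refine HasSum.of_nat_succ ((h0.mul_left Q).congr_fun fun n => ?_) (by simp)
    rw [mul_smul_comm, ← pow_succ', Nat.factorial_succ]
    congr 1
    push_cast
    field_simp
    ring
  have h2 : HasSum (fun n : ℕ => (τ ^ n / n.factorial * (1 - n / τ)) • Q ^ n)
      ((1 - Q) * exp (τ • Q)) := by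
    rw [sub_mul, one_mul]
    refine (h0.sub h1).congr_fun fun n => ?_
    rw [← sub_smul]
    congr 1
    ring
  have h3 : HasSum (fun n : ℕ => τ ^ n / n.factorial) (Real.exp τ) := by
    rw [Real.exp_eq_exp_ℝ]
    exact expSeries_div_hasSum_exp τ
  have hr : 0 < √τ := Real.sqrt_pos.2 hτ
  have hsq : √τ ^ 2 = τ := Real.sq_sqrt hτ.le
  have h4 : ‖(1 - Q) * exp (τ • Q)‖ ≤ Real.exp τ / √τ := by
    have h5 := (h3.mul_left (1 / (2 * √τ))).add ((hasSum_poisson_variance hτ).mul_left (√τ / 2))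
    have h6 : 1 / (2 * √τ) * Real.exp τ + √τ / 2 * (Real.exp τ / τ) = Real.exp τ / √τ := by
      field_simp
      rw [hsq]
      ring
    rw [h6] at h5
    refine h2.norm_le_of_bounded h5 fun n => ?_
    rw [norm_smul, norm_mul, Real.norm_of_nonneg (by positivity : 0 ≤ τ ^ n / n.factorial),
      Real.norm_eq_abs]
    have hp : 0 ≤ τ ^ n / n.factorial := by positivity
    -- the arithmetic-geometric mean inequality, with weights balanced at the variance `1 / τ`
    have hamgm : |1 - n / τ| ≤ 1 / (2 * √τ) + √τ / 2 * (1 - n / τ) ^ 2 := by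
      rw [← sq_abs (1 - n / τ)]
      rw [← sub_nonneg]
      have e : 1 / (2 * √τ) + √τ / 2 * |1 - n / τ| ^ 2 - |1 - n / τ|
          = (1 - √τ * |1 - n / τ|) ^ 2 / (2 * √τ) := by
        field_simp
        ring
      rw [e]
      positivity
    calc τ ^ n / n.factorial * |1 - n / τ| * ‖Q ^ n‖
        ≤ τ ^ n / n.factorial * |1 - n / τ| * 1 := by
          gcongr
          exact hQ n
      _ ≤ τ ^ n / n.factorial * (1 / (2 * √τ) + √τ / 2 * (1 - n / τ) ^ 2) := by
          rw [mul_one]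
          gcongr
      _ = _ := by ring
  rw [exp_smul_sub_one, mul_smul_comm, norm_smul, Real.norm_of_nonneg (Real.exp_pos _).le]
  calc Real.exp (-τ) * ‖(1 - Q) * exp (τ • Q)‖ ≤ Real.exp (-τ) * (Real.exp τ / √τ) := by gcongr
    _ = 1 / √τ := by rw [← mul_div_assoc, ← Real.exp_add, neg_add_cancel, Real.exp_zero]

end Banach

/-! ### The semigroup generated by a dissipative operator -/

section Flow
variable {E : Type*} [NormedAddCommGroup E] [NormedSpace ℝ E] [CompleteSpace E]

/-- The hypothesis on `L` makes `Q = 1 - c⁻¹ L` a contraction, and `L exp (-s L)` equals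
`c (1 - Q) exp (c s (Q - 1))`. -/
theorem tendsto_exp_neg_smul_apply_apply {L : E →L[ℝ] E} {c : ℝ} (hc : 0 < c)
    (hL : ‖c • 1 - L‖ ≤ c) (u : E) :
    Tendsto (fun s : ℝ => NormedSpace.exp ((-s) • L) (L u)) atTop (𝓝 0) := by
  set Q : E →L[ℝ] E := 1 - c⁻¹ • L with hQdef
  have hQ1 : ‖Q‖ ≤ 1 := by
    have : Q = c⁻¹ • (c • 1 - L) := by rw [smul_sub, smul_smul, inv_mul_cancel₀ hc.ne', one_smul]
    rw [this, norm_smul, Real.norm_of_nonneg (by positivity), inv_mul_le_iff₀ hc, mul_one]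
    exact hL
  have hQ : ∀ n : ℕ, ‖Q ^ n‖ ≤ 1 := by
    intro n
    induction n with
    | zero => exact ContinuousLinearMap.norm_id_le
    | succ n ih =>
      rw [pow_succ]
      exact (norm_mul_le _ _).trans (mul_le_one₀ ih (norm_nonneg _) hQ1)
  have hLQ : L = c • (1 - Q) := by
    rw [hQdef, sub_sub_cancel, smul_smul, mul_inv_cancel₀ hc.ne', one_smul]
  have hb : Tendsto (fun s : ℝ => c * (1 / √(c * s)) * ‖u‖) atTop (𝓝 0) := by
    have h : Tendsto (fun s : ℝ => √(c * s)) atTop atTop :=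
      Real.tendsto_sqrt_atTop.comp (tendsto_id.const_mul_atTop hc)
    have := ((tendsto_inv_atTop_zero.comp h).const_mul c).mul_const ‖u‖
    simpa [Function.comp_def] using this
  refine squeeze_zero_norm' ?_ hb
  filter_upwards [eventually_gt_atTop 0] with s hs
  have e1 : (-s) • L = (c * s) • (Q - 1) := by
    rw [hLQ, smul_smul, ← neg_sub Q 1, smul_neg, ← neg_smul]
    congr 1
    ring
  have hcomm : Commute (NormedSpace.exp ((c * s) • (Q - 1))) L := by
    refine Commute.exp_left ?_
    rw [hLQ]
    exact (((Commute.one_right _).sub_right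
      ((Commute.refl Q).sub_left (Commute.one_left Q))).smul_right _).smul_left _
  have e2 : NormedSpace.exp ((-s) • L) (L u)
      = (c • ((1 - Q) * NormedSpace.exp ((c * s) • (Q - 1)))) u := by
    rw [e1, ← smul_mul_assoc, ← hLQ]
    exact congrArg (fun B : E →L[ℝ] E => B u) hcomm.eq
  rw [e2]
  refine (ContinuousLinearMap.le_opNorm _ _).trans ?_
  rw [norm_smul, Real.norm_of_nonneg hc.le]
  gcongr
  exact norm_one_sub_mul_exp_le hQ (by positivity)

theorem exp_add_smul_apply (a b : ℝ) (L : E →L[ℝ] E) (v : E) :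
    NormedSpace.exp ((a + b) • L) v = NormedSpace.exp (a • L) (NormedSpace.exp (b • L) v) :=
  congrArg (fun B : E →L[ℝ] E => B v) (exp_add_smul a b L)

theorem exp_smul_apply_of_apply_eq_zero {L : E →L[ℝ] E} {z : E} (hz : L z = 0) (a : ℝ) :
    NormedSpace.exp (a • L) z = z := by
  have h : ∀ t : ℝ, HasDerivAt (fun u : ℝ => NormedSpace.exp (u • L) z) 0 t := by
    intro t
    have := (hasDerivAt_exp_smul_const (𝕂 := ℝ) L t).clm_apply (hasDerivAt_const t z)
    simpa [hz] using this
  have := is_const_of_deriv_eq_zero (fun t => (h t).differentiableAt) (fun t => (h t).deriv) a 0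
  simpa using this

/-- The flow of `-L` fixes the kernel pointwise and contracts the range to zero. -/
theorem apply_eq_zero_of_apply_apply_eq_zero {L : E →L[ℝ] E} {c : ℝ} (hc : 0 < c)
    (hL : ‖c • 1 - L‖ ≤ c) {u : E} (hu : L (L u) = 0) : L u = 0 := by
  have h := tendsto_exp_neg_smul_apply_apply hc hL u
  simp only [exp_smul_apply_of_apply_eq_zero hu] at h
  exact tendsto_nhds_unique tendsto_const_nhds h

theorem exists_ker_sub_mem_range [FiniteDimensional ℝ E] {L : E →L[ℝ] E} {c : ℝ} (hc : 0 < c)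
    (hL : ‖c • 1 - L‖ ≤ c) (x₀ : E) : ∃ z u, L z = 0 ∧ x₀ = z + L u := by
  have hd : Disjoint (LinearMap.ker (L : E →ₗ[ℝ] E)) (LinearMap.range (L : E →ₗ[ℝ] E)) := by
    rw [Submodule.disjoint_def]
    rintro _ hk ⟨u, rfl⟩
    exact apply_eq_zero_of_apply_apply_eq_zero hc hL hk
  have ht := Submodule.eq_top_of_disjoint _ _ (by
    rw [add_comm, LinearMap.finrank_range_add_finrank_ker]) hd
  have hx : x₀ ∈ LinearMap.ker (L : E →ₗ[ℝ] E) ⊔ LinearMap.range (L : E →ₗ[ℝ] E) := by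
    rw [ht]
    trivial
  obtain ⟨z, hz, _, ⟨u, rfl⟩, h⟩ := Submodule.mem_sup.1 hx
  exact ⟨z, u, hz, h.symm⟩

theorem tendsto_exp_neg_smul_apply {L : E →L[ℝ] E} {c : ℝ} (hc : 0 < c)
    (hL : ‖c • 1 - L‖ ≤ c) {z : E} (hz : L z = 0) (u : E) :
    Tendsto (fun s : ℝ => NormedSpace.exp ((-s) • L) (z + L u)) atTop (𝓝 z) := by
  have h := (tendsto_exp_neg_smul_apply_apply hc hL u).const_add z
  rw [add_zero] at h
  refine h.congr fun s => ?_
  rw [map_add, exp_smul_apply_of_apply_eq_zero hz]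

theorem HasDerivAt.exp_neg_smul_apply (L : E →L[ℝ] E) {A : ℝ → ℝ} {a t : ℝ}
    (hA : HasDerivAt A a t) (v : E) :
    HasDerivAt (fun r => NormedSpace.exp ((-A r) • L) v)
      (-(a • L (NormedSpace.exp ((-A t) • L) v))) t := by
  have hneg : HasDerivAt (fun r => -A r) (-a) t := hA.neg
  have h : HasDerivAt (fun r => (NormedSpace.exp ((-A r) • L) : E →L[ℝ] E))
      ((-a) • (L * NormedSpace.exp ((-A t) • L))) t :=
    HasDerivAt.scomp (g₁ := fun u : ℝ => (NormedSpace.exp (u • L) : E →L[ℝ] E)) t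
      (hasDerivAt_exp_smul_const' (𝕂 := ℝ) L (-A t)) hneg
  have h' := h.clm_apply (hasDerivAt_const t v)
  rw [map_zero, add_zero, neg_smul] at h'
  exact h'

/-- Uniqueness for the equation `ẋ = -a(t) L x`: up to the change of time `A` with `A' = a`, its
solutions are those of the autonomous equation. -/
theorem eq_exp_apply_of_hasDerivWithinAt (L : E →L[ℝ] E) {A a : ℝ → ℝ} {x : ℝ → E} {s b : ℝ}
    (hsb : s ≤ b) (hA : ∀ t ∈ Set.Icc s b, HasDerivAt A (a t) t)
    (hxc : ContinuousOn x (Set.Icc s b))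
    (hx : ∀ t ∈ Set.Ico s b, HasDerivWithinAt x (-(a t • L (x t))) (Set.Ici t) t) :
    x b = NormedSpace.exp ((-(A b - A s)) • L) (x s) := by
  have hE : ∀ t ∈ Set.Icc s b, HasDerivAt (fun r => NormedSpace.exp (A r • L))
      (a t • (NormedSpace.exp (A t • L) * L)) t := fun t ht =>
    (hasDerivAt_exp_smul_const (𝕂 := ℝ) L (A t)).scomp t (hA t ht)
  have hconst := constant_of_has_deriv_right_zero (f := fun t => NormedSpace.exp (A t • L) (x t))
    (a := s) (b := b)
    (fun t ht => (hE t ht).continuousAt.continuousWithinAt.clm_apply (hxc t ht))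
    (fun t ht => by
      have := (hE t ⟨ht.1, ht.2.le⟩).hasDerivWithinAt.clm_apply (hx t ht)
      simpa using this) b ⟨hsb, le_rfl⟩
  have h := congrArg (NormedSpace.exp ((-A b) • L) : E →L[ℝ] E) hconst
  rw [← exp_add_smul_apply, ← exp_add_smul_apply, neg_add_cancel, zero_smul,
    NormedSpace.exp_zero] at h
  rw [neg_sub, sub_eq_neg_add]
  exact h

end Flow

namespace SignedDigraph

/-! ### The Laplacian and its kernel -/

section Laplacian
variable {V : Type*} [Fintype V] (G : SignedDigraph V)

theorem sum_inNeighbors {f : V → ℝ} {k : V} (hf : ∀ l, G.w k l = 0 → f l = 0) :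
    ∑ l ∈ G.inNeighbors k, f l = ∑ l, f l :=
  Finset.sum_subset (Finset.subset_univ _) fun l _ hl => hf l (by simpa [inNeighbors] using hl)

variable [DecidableEq V]

theorem laplacian_mulVec_apply (y : V → ℝ) (k : V) :
    G.laplacian.mulVec y k = ∑ l, (|G.w k l| * y k - G.w k l * y l) := by
  rw [laplacian, Matrix.sub_mulVec, Pi.sub_apply, Matrix.mulVec_diagonal,
    G.sum_inNeighbors (fun l hl => by simp [hl]), Finset.sum_sub_distrib, Finset.sum_mul]
  rfl

/-- The Laplacian as a continuous linear operator; its operator norm is that of the supremum norm,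
for which the Laplacian generates a contraction semigroup. -/
noncomputable def laplacianCLM : (V → ℝ) →L[ℝ] (V → ℝ) :=
  LinearMap.toContinuousLinearMap G.laplacian.mulVecLin

theorem laplacianCLM_apply (y : V → ℝ) (k : V) :
    G.laplacianCLM y k = ∑ l, (|G.w k l| * y k - G.w k l * y l) :=
  G.laplacian_mulVec_apply y k

theorem control_eq (ρ₁ ρ₂ κ T t : ℝ) (y : V → ℝ) (k : V) :
    G.control ρ₁ ρ₂ κ T t y k
      = -((ρ₁ + ρ₂ * (phiDot κ T t / phi κ T t)) * G.laplacianCLM y k) := by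
  rw [control, G.sum_inNeighbors (fun l hl => by simp [hl]), laplacianCLM_apply, ← mul_neg,
    ← Finset.sum_neg_distrib]
  congr 1
  refine Finset.sum_congr rfl fun l _ => ?_
  have h : G.w k l * Real.sign (G.w k l) = |G.w k l| := by
    rcases lt_trichotomy (G.w k l) 0 with h | h | h
    · rw [Real.sign_of_neg h, abs_of_neg h, mul_neg_one]
    · simp [h]
    · rw [Real.sign_of_pos h, abs_of_pos h, mul_one]
  rw [mul_sub, ← mul_assoc, h]
  ring

/-- Diagonal dominance of the Laplacian, as a bound in the operator norm. -/
theorem exists_norm_smul_one_sub_laplacianCLM_le :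
    ∃ c : ℝ, 0 < c ∧ ‖c • 1 - G.laplacianCLM‖ ≤ c := by
  have hS : 0 ≤ ∑ k, ∑ l, |G.w k l| := by positivity
  refine ⟨1 + ∑ k, ∑ l, |G.w k l|, by positivity, ?_⟩
  set c := 1 + ∑ k, ∑ l, |G.w k l|
  refine ContinuousLinearMap.opNorm_le_bound _ (by positivity) fun y => ?_
  refine (pi_norm_le_iff_of_nonneg (by positivity)).2 fun k => ?_
  have hk : ∑ l, |G.w k l| ≤ c := by
    have := Finset.single_le_sum (f := fun k => ∑ l, |G.w k l|) (fun k _ => by positivity)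
      (Finset.mem_univ k)
    simp only [c]
    linarith
  have e : (c • (1 : (V → ℝ) →L[ℝ] (V → ℝ)) - G.laplacianCLM) y k
      = (c - ∑ l, |G.w k l|) * y k + ∑ l, G.w k l * y l := by
    have : (c • (1 : (V → ℝ) →L[ℝ] (V → ℝ)) - G.laplacianCLM) y k
        = c * y k - G.laplacianCLM y k := rfl
    rw [this, laplacianCLM_apply, Finset.sum_sub_distrib, ← Finset.sum_mul]
    ring
  rw [e, Real.norm_eq_abs]
  calc |(c - ∑ l, |G.w k l|) * y k + ∑ l, G.w k l * y l|
      ≤ (c - ∑ l, |G.w k l|) * |y k| + ∑ l, |G.w k l| * |y l| := by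
        refine (abs_add_le _ _).trans ?_
        rw [abs_mul, abs_of_nonneg (sub_nonneg.2 hk)]
        gcongr
        refine (Finset.abs_sum_le_sum_abs _ _).trans_eq ?_
        simp only [abs_mul]
    _ ≤ (c - ∑ l, |G.w k l|) * ‖y‖ + ∑ l, |G.w k l| * ‖y‖ := by
        have h := sub_nonneg.2 hk
        gcongr
        · exact norm_le_pi_norm y k
        · exact norm_le_pi_norm y _
    _ = c * ‖y‖ := by
        rw [← Finset.sum_mul]
        ring

variable {G}

/-- The maximum principle for the kernel of the Laplacian: where the modulus is locally maximal, the
in-neighbours have the same modulus, with the sign prescribed by the edge. -/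
theorem mul_eq_of_laplacianCLM_eq_zero {z : V → ℝ} (hz : G.laplacianCLM z = 0) {k : V}
    (hk : ∀ l, G.Edge l k → |z l| ≤ |z k|) (l : V) : G.w k l * z l = |G.w k l| * z k := by
  have h0 : ∑ l, (|G.w k l| * z k - G.w k l * z l) = 0 := by
    rw [← laplacianCLM_apply, hz]
    rfl
  have hle : ∀ l, |G.w k l * z l| ≤ |G.w k l| * |z k| := by
    intro l
    rw [abs_mul]
    rcases eq_or_ne (G.w k l) 0 with h | h
    · simp [h]
    · exact mul_le_mul_of_nonneg_left (hk l h) (abs_nonneg _)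
  rcases le_total 0 (z k) with h | h
  · have := (Finset.sum_eq_zero_iff_of_nonneg (fun l _ => by
      have := (abs_le.1 (hle l)).2
      rw [abs_of_nonneg h] at this
      linarith)).1 h0 l (Finset.mem_univ l)
    linarith
  · have := (Finset.sum_eq_zero_iff_of_nonpos (fun l _ => by
      have := (abs_le.1 (hle l)).1
      rw [abs_of_nonpos h] at this
      linarith)).1 h0 l (Finset.mem_univ l)
    linarith

theorem abs_eq_of_edge {z : V → ℝ} (hz : G.laplacianCLM z = 0) {k l : V}
    (hk : ∀ l, |z l| ≤ |z k|) (h : G.Edge l k) : |z l| = |z k| := by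
  have e := congrArg abs (mul_eq_of_laplacianCLM_eq_zero hz (fun l _ => hk l) l)
  rw [abs_mul, abs_mul, abs_abs] at e
  exact mul_left_cancel₀ (abs_ne_zero.2 h) e

theorem abs_eq_of_path {z : V → ℝ} (hz : G.laplacianCLM z = 0) {k l : V}
    (hk : ∀ l, |z l| ≤ |z k|) (h : G.Path l k) : |z l| = |z k| := by
  refine Relation.ReflTransGen.head_induction_on h rfl fun {a b} hab _ ih => ?_
  rw [← ih]
  exact abs_eq_of_edge hz (fun l => ih ▸ hk l) hab

theorem StronglyConnected.abs_eq {z : V → ℝ} (hG : G.StronglyConnected)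
    (hz : G.laplacianCLM z = 0) (k l : V) : |z k| = |z l| := by
  have : Nonempty V := ⟨k⟩
  obtain ⟨m, hm⟩ := Finite.exists_max fun k => |z k|
  rw [abs_eq_of_path hz hm (hG k m), abs_eq_of_path hz hm (hG l m)]

/-- The moduli of an element of the kernel agree, so if it is not zero, its signs are a balancing
bipartition. -/
theorem StronglyConnected.eq_zero_of_not_balanced {z : V → ℝ} (hG : G.StronglyConnected)
    (hb : ¬ G.StructurallyBalanced) (hz : G.laplacianCLM z = 0) : z = 0 := by
  by_contra hne
  obtain ⟨k₀, hk₀⟩ := Function.ne_iff.1 hne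
  have hne' : ∀ k, z k ≠ 0 := fun k => by
    rw [← abs_pos, hG.abs_eq hz k k₀]
    exact abs_pos.2 hk₀
  have he := fun k l => mul_eq_of_laplacianCLM_eq_zero hz (fun l _ => (hG.abs_eq hz l k).le) l
  refine hb ⟨{k | 0 < z k}, {k | z k < 0}, ?_, ?_, ?_, ?_, ?_, ?_⟩
  · ext k
    simpa using fun h : 0 < z k => h.le
  · ext k
    simpa using (hne' k).lt_or_gt.symm
  · intro k (hk : 0 < z k) l (hl : 0 < z l)
    have := mul_nonneg (abs_nonneg (G.w k l)) hk.le
    rw [← he] at this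
    exact nonneg_of_mul_nonneg_left this hl
  · intro k (hk : z k < 0) l (hl : z l < 0)
    have := mul_nonpos_of_nonneg_of_nonpos (abs_nonneg (G.w k l)) hk.le
    rw [← he] at this
    by_contra! h
    linarith [mul_pos_of_neg_of_neg h hl]
  · intro k (hk : 0 < z k) l (hl : z l < 0)
    have := mul_nonneg (abs_nonneg (G.w k l)) hk.le
    rw [← he] at this
    by_contra! h
    linarith [mul_neg_of_pos_of_neg h hl]
  · intro k (hk : z k < 0) l (hl : 0 < z l)
    have := mul_nonpos_of_nonneg_of_nonpos (abs_nonneg (G.w k l)) hk.le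
    rw [← he] at this
    by_contra! h
    linarith [mul_pos h hl]

/-- The signs of a balancing bipartition form a nonzero element of the kernel. -/
theorem StructurallyBalanced.range_laplacian_ne_top [Nonempty V] (hb : G.StructurallyBalanced) :
    LinearMap.range G.laplacian.mulVecLin ≠ ⊤ := by
  classical
  obtain ⟨V₁, V₂, hd, hu, h11, h22, h12, h21⟩ := hb
  have hV : ∀ k, k ∉ V₁ → k ∈ V₂ := fun k hk =>
    ((hu ▸ Set.mem_univ k : k ∈ V₁ ∪ V₂)).resolve_left hk
  intro htop
  have hinj := LinearMap.injective_iff_surjective.2 (LinearMap.range_eq_top.1 htop)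
  have hσ : G.laplacian.mulVecLin (fun k => if k ∈ V₁ then 1 else -1) = 0 := by
    ext k
    rw [Matrix.mulVecLin_apply, laplacian_mulVec_apply]
    refine Finset.sum_eq_zero fun l _ => ?_
    by_cases hk : k ∈ V₁ <;> by_cases hl : l ∈ V₁
    · simp [hk, hl, abs_of_nonneg (h11 k hk l hl)]
    · simp [hk, hl, abs_of_nonpos (h12 k hk l (hV l hl))]
    · simp [hk, hl, abs_of_nonpos (h21 k (hV k hk) l hl)]
    · simp [hk, hl, abs_of_nonneg (h22 k (hV k hk) l (hV l hl))]
  have h := congrFun (hinj (hσ.trans (map_zero _).symm)) (Classical.arbitrary V)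
  simp only [Pi.zero_apply] at h
  split_ifs at h <;> norm_num at h

end Laplacian

/-! ### Closed strong components -/

section Components
variable {V : Type*} {G : SignedDigraph V}

theorem path_induce {C : Finset V} (hC : ∀ k ∈ C, ∀ l, G.Edge l k → l ∈ C) {k l : V}
    (h : G.Path k l) (hl : l ∈ C) : ∃ hk : k ∈ C, (G.induce C).Path ⟨k, hk⟩ ⟨l, hl⟩ := by
  refine Relation.ReflTransGen.head_induction_on h ⟨hl, .refl⟩ fun {a b} hab _ ih => ?_
  obtain ⟨hb, ih⟩ := ih
  exact ⟨hC b hb a hab,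
    Relation.ReflTransGen.head (b := (⟨b, hb⟩ : C)) (show G.Edge a b from hab) ih⟩

theorem Path.of_induce {C : Finset V} {k l : C} (h : (G.induce C).Path k l) : G.Path k l :=
  Relation.ReflTransGen.lift (r := (G.induce C).Edge) (p := G.Edge) Subtype.val
    (fun _ _ h => h) _ _ h

/-- Every node is reached from a closed strong component: among the ancestors of the node, take one
with the fewest ancestors; these form the component. -/
theorem exists_isClosedStrongComponent_path [Fintype V] (G : SignedDigraph V) (k : V) :
    ∃ C, G.IsClosedStrongComponent C ∧ ∃ c ∈ C, G.Path c k := by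
  classical
  let anc : V → Finset V := fun c => Finset.univ.filter fun d => G.Path d c
  have mem_anc : ∀ {c d}, d ∈ anc c ↔ G.Path d c := by simp [anc]
  obtain ⟨c, hc, hmin⟩ := (anc k).exists_min_image (fun c => (anc c).card)
    ⟨k, mem_anc.2 .refl⟩
  have hclosed : ∀ a ∈ anc c, ∀ b, G.Edge b a → b ∈ anc c := fun a ha b hba =>
    mem_anc.2 ((mem_anc.1 ha).head hba)
  have hback : ∀ d ∈ anc c, G.Path c d := by
    intro d hd
    have hsub : anc d ⊆ anc c := fun b hb => mem_anc.2 ((mem_anc.1 hb).trans (mem_anc.1 hd))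
    have := Finset.eq_of_subset_of_card_le hsub
      (hmin d (mem_anc.2 ((mem_anc.1 hd).trans (mem_anc.1 hc))))
    exact mem_anc.1 (this ▸ mem_anc.2 .refl)
  refine ⟨anc c, ⟨⟨c, mem_anc.2 .refl⟩, ?_, ?_, ?_⟩, c, mem_anc.2 .refl, mem_anc.1 hc⟩
  · rintro ⟨a, ha⟩ ⟨b, hb⟩
    exact (path_induce hclosed ((mem_anc.1 ha).trans (hback b hb)) hb).2
  · intro C' hsub hC'
    refine (hsub.antisymm fun d hd => mem_anc.2 ?_).symm
    exact (hC' ⟨d, hd⟩ ⟨c, hsub (mem_anc.2 .refl)⟩).of_induce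
  · intro a ha b hb hba
    exact hb (hclosed a ha b hba)

variable [Fintype V]

theorem abs_le_leaderMax_of_isLeader (y : V → ℝ) {k : V} (hk : G.IsLeader k) :
    |y k| ≤ G.leaderMax y :=
  le_ciSup (f := fun k : {k // G.IsLeader k} => |y k|) (Set.finite_range _).bddAbove ⟨k, hk⟩

theorem continuous_leaderMax [Nonempty V] : Continuous G.leaderMax := by
  classical
  obtain ⟨C, hC, c, hc, -⟩ := G.exists_isClosedStrongComponent_path (Classical.arbitrary V)
  have : Nonempty {k // G.IsLeader k} := ⟨⟨c, C, hC, hc⟩⟩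
  have e : G.leaderMax = fun y => Finset.univ.sup' Finset.univ_nonempty
      fun k : {k // G.IsLeader k} => |y k| := by
    ext y
    rw [Finset.sup'_univ_eq_ciSup]
    rfl
  rw [e]
  exact Continuous.finset_sup'_apply _ fun k _ => (continuous_apply _).abs

variable [DecidableEq V]

/-- No edge enters a closed strong component, so its Laplacian is a diagonal block of the Laplacian
with zeros in the rest of its rows. -/
theorem IsClosedStrongComponent.laplacianCLM_induce {C : Finset V}
    (hC : G.IsClosedStrongComponent C) (y : V → ℝ) :
    (G.induce C).laplacianCLM (fun k : C => y k) = fun k : C => G.laplacianCLM y k := by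
  ext k
  rw [laplacianCLM_apply, laplacianCLM_apply]
  refine (Finset.sum_coe_sort C fun l => |G.w k l| * y k - G.w k l * y l).trans
    (Finset.sum_subset (Finset.subset_univ _) fun l _ hl => ?_)
  have h : G.w k l = 0 := not_not.1 (hC.closed k k.2 l hl)
  simp [h]

/-- An element of the kernel of the Laplacian attains its maximal modulus on a closed strong
component. -/
theorem exists_isClosedStrongComponent_abs_le [Nonempty V] {z : V → ℝ}
    (hz : G.laplacianCLM z = 0) :
    ∃ C, G.IsClosedStrongComponent C ∧ ∃ c ∈ C, ∀ k, |z k| ≤ |z c| := by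
  obtain ⟨m, hm⟩ := Finite.exists_max fun k => |z k|
  obtain ⟨C, hC, c, hc, hcm⟩ := G.exists_isClosedStrongComponent_path m
  exact ⟨C, hC, c, hc, fun k => (hm k).trans_eq (abs_eq_of_path hz hm hcm).symm⟩

theorem IsClosedStrongComponent.eq_zero_of_not_balanced {C : Finset V}
    (hC : G.IsClosedStrongComponent C) (hb : ¬ (G.induce C).StructurallyBalanced) {z : V → ℝ}
    (hz : G.laplacianCLM z = 0) {k : V} (hk : k ∈ C) : z k = 0 := by
  have h := hC.stronglyConnected.eq_zero_of_not_balanced hb (z := fun k : C => z k) (by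
    rw [hC.laplacianCLM_induce, hz]
    rfl)
  exact congrFun h ⟨k, hk⟩

theorem abs_le_leaderMax {z : V → ℝ} (hz : G.laplacianCLM z = 0) (l : V) :
    |z l| ≤ G.leaderMax z := by
  have : Nonempty V := ⟨l⟩
  obtain ⟨C, hC, c, hc, hmax⟩ := exists_isClosedStrongComponent_abs_le hz
  exact (hmax l).trans (abs_le_leaderMax_of_isLeader z ⟨C, hC, hc⟩)

end Components
end SignedDigraph

/-! ### The gain of the protocol -/

theorem phiDot_div_phi_of_lt {κ T t : ℝ} (hκ : 0 < κ) (hT : 0 < T) (ht : t < T) :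
    phiDot κ T t / phi κ T t = κ / (T - t) := by
  have hs : 0 < T - t := sub_pos.2 ht
  have hφ : phi κ T t = (T / (T - t)) ^ κ := by
    rw [phi, if_pos ht, Real.div_rpow hT.le hs.le]
  have hpos : 0 < phi κ T t := by
    rw [hφ]
    positivity
  have hroot : phi κ T t ^ (1 / κ) = T / (T - t) := by
    rw [hφ, ← Real.rpow_mul (by positivity), mul_one_div_cancel hκ.ne', Real.rpow_one]
  rw [phiDot, if_pos ht, Real.rpow_add hpos, Real.rpow_one, hroot]
  field_simp

namespace SignedDigraph

/-- The gain of the protocol integrated over `[0, t]`, for `t < T`. It is the time of the autonomous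
flow of the Laplacian that the network has run through by time `t`. -/
noncomputable def intrinsicTime (ρ₁ ρ₂ κ T t : ℝ) : ℝ :=
  ρ₁ * t + ρ₂ * κ * (Real.log T - Real.log (T - t))

theorem intrinsicTime_zero (ρ₁ ρ₂ κ T : ℝ) : intrinsicTime ρ₁ ρ₂ κ T 0 = 0 := by
  simp [intrinsicTime]

theorem hasDerivAt_intrinsicTime {ρ₁ ρ₂ κ T t : ℝ} (hκ : 0 < κ) (hT : 0 < T) (ht : t < T) :
    HasDerivAt (intrinsicTime ρ₁ ρ₂ κ T) (ρ₁ + ρ₂ * (phiDot κ T t / phi κ T t)) t := by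
  have hs : T - t ≠ 0 := (sub_pos.2 ht).ne'
  have h := ((hasDerivAt_id t).const_mul ρ₁).add
    (((((hasDerivAt_id t).const_sub T).log hs).const_sub (Real.log T)).const_mul (ρ₂ * κ))
  refine h.congr_deriv ?_
  rw [phiDot_div_phi_of_lt hκ hT ht, id]
  field_simp

theorem tendsto_intrinsicTime {ρ₁ ρ₂ κ : ℝ} (hρ₂ : 0 < ρ₂) (hκ : 0 < κ) (T : ℝ) :
    Tendsto (intrinsicTime ρ₁ ρ₂ κ T) (𝓝[<] T) atTop := by
  have hsub : Tendsto (fun t => T - t) (𝓝[<] T) (𝓝[>] 0) := by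
    refine tendsto_nhdsWithin_iff.2 ⟨?_, ?_⟩
    · have : Tendsto (fun t => T - t) (𝓝 T) (𝓝 (T - T)) :=
        (continuous_const.sub continuous_id).tendsto T
      rw [sub_self] at this
      exact this.mono_left nhdsWithin_le_nhds
    · filter_upwards [self_mem_nhdsWithin] with t ht using sub_pos.2 (Set.mem_Iio.1 ht)
  have hlog : Tendsto (fun t => Real.log T - Real.log (T - t)) (𝓝[<] T) atTop := by
    simp only [sub_eq_add_neg (Real.log T)]
    exact tendsto_atTop_add_const_left _ _
      (tendsto_neg_atBot_atTop.comp (Real.tendsto_log_nhdsGT_zero.comp hsub))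
  have hlin : Tendsto (fun t => ρ₁ * t) (𝓝[<] T) (𝓝 (ρ₁ * T)) :=
    ((continuous_const.mul continuous_id).tendsto T).mono_left nhdsWithin_le_nhds
  exact hlin.add_atTop (hlog.const_mul_atTop (by positivity))

/-! ### Trajectories -/

theorem prescribedTimeStability_of_tendsto {V : Type*} {S : Set V} {T : ℝ} {x : ℝ → V → ℝ}
    {z : V → ℝ}
    (hlim : Tendsto x (𝓝 T) (𝓝 z)) (hrest : ∀ t ≥ T, x t = z) (hS : ∀ k ∈ S, z k = 0) :
    PrescribedTimeStability S T x := fun k hk =>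
  ⟨hS k hk ▸ tendsto_pi_nhds.1 hlim k, fun t ht => (congrFun (hrest t ht) k).trans (hS k hk)⟩

section Trajectories
variable {V : Type*} [Fintype V] {G : SignedDigraph V} {ρ₁ ρ₂ κ T : ℝ}

theorem IsTrajectory.tendsto (hT : 0 < T) {x : ℝ → V → ℝ} (hx : G.IsTrajectory ρ₁ ρ₂ κ T x)
    {z : V → ℝ} (h : x T = z) : Tendsto x (𝓝 T) (𝓝 z) :=
  h ▸ hx.continuousOn.continuousAt (Ici_mem_nhds hT)

variable [DecidableEq V]

/-- Before `T` a trajectory follows the flow of the Laplacian, which reaches infinite intrinsic time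
at `T`; from `T` on it rests at the limit, which is an equilibrium. -/
theorem IsTrajectory.eq_of_ge (hρ₂ : 0 < ρ₂) (hκ : 0 < κ) (hT : 0 < T) {x : ℝ → V → ℝ}
    (hx : G.IsTrajectory ρ₁ ρ₂ κ T x) {z u : V → ℝ} (hz : G.laplacianCLM z = 0)
    (hx0 : x 0 = z + G.laplacianCLM u) {t : ℝ} (ht : T ≤ t) : x t = z := by
  obtain ⟨c, hc, hL⟩ := G.exists_norm_smul_one_sub_laplacianCLM_le
  have hbefore : ∀ b ∈ Set.Ico 0 T, x b
      = NormedSpace.exp ((-intrinsicTime ρ₁ ρ₂ κ T b) • G.laplacianCLM)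
        (z + G.laplacianCLM u) := by
    intro b hb
    have h := eq_exp_apply_of_hasDerivWithinAt G.laplacianCLM hb.1
      (A := intrinsicTime ρ₁ ρ₂ κ T) (x := x)
      (fun t ht => hasDerivAt_intrinsicTime hκ hT (ht.2.trans_lt hb.2))
      (hx.continuousOn.mono fun t ht => ht.1)
      (fun t ht => hasDerivWithinAt_pi.2 fun k => by
        have := (hx.before t ⟨ht.1, ht.2.trans hb.2⟩ k).mono (Set.Ici_subset_Ici.2 ht.1)
        rw [control_eq] at this
        exact this)
    rw [h, intrinsicTime_zero, sub_zero, hx0]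
  have hxT : x T = z := by
    have h1 : Tendsto x (𝓝[<] T) (𝓝 (x T)) :=
      (hx.continuousOn.continuousAt (Ici_mem_nhds hT)).mono_left nhdsWithin_le_nhds
    refine tendsto_nhds_unique h1
      (((tendsto_exp_neg_smul_apply hc hL hz u).comp
        (tendsto_intrinsicTime (ρ₁ := ρ₁) hρ₂ hκ T)).congr' ?_)
    filter_upwards [Ioo_mem_nhdsLT hT] with b hb using (hbefore b ⟨hb.1.le, hb.2⟩).symm
  have h := eq_exp_apply_of_hasDerivWithinAt G.laplacianCLM ht (A := fun t => ρ₁ * t)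
    (a := fun _ => ρ₁) (x := x) (fun t _ => by simpa using (hasDerivAt_id t).const_mul ρ₁)
    (hx.continuousOn.mono fun s hs => hT.le.trans hs.1)
    (fun s hs => hasDerivWithinAt_pi.2 fun k => by
      have := (hx.after s hs.1 k).mono (Set.Ici_subset_Ici.2 hs.1)
      rw [control_eq, phiDot, if_neg hs.1.not_gt, zero_div, mul_zero, add_zero] at this
      exact this)
  rw [h, hxT, exp_smul_apply_of_apply_eq_zero hz]

theorem exists_isTrajectory (hρ₂ : 0 < ρ₂) (hκ : 0 < κ) (hT : 0 < T) (x₀ : V → ℝ) :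
    ∃ x, G.IsTrajectory ρ₁ ρ₂ κ T x ∧ x 0 = x₀ := by
  obtain ⟨c, hc, hL⟩ := G.exists_norm_smul_one_sub_laplacianCLM_le
  obtain ⟨z, u, hz, rfl⟩ := exists_ker_sub_mem_range hc hL x₀
  set f : ℝ → V → ℝ := fun t =>
    NormedSpace.exp ((-intrinsicTime ρ₁ ρ₂ κ T t) • G.laplacianCLM) (z + G.laplacianCLM u) with hf
  have hfd : ∀ t < T, HasDerivAt f
      (-((ρ₁ + ρ₂ * (phiDot κ T t / phi κ T t)) • G.laplacianCLM (f t))) t := fun t ht =>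
    (hasDerivAt_intrinsicTime hκ hT ht).exp_neg_smul_apply _ _
  set x : ℝ → V → ℝ := fun t => if t < T then f t else z with hxdef
  have hlt : ∀ t < T, x t = f t := fun t ht => if_pos ht
  have hge : ∀ t, T ≤ t → x t = z := fun t ht => if_neg ht.not_gt
  have hev : ∀ t < T, x =ᶠ[𝓝 t] f := fun t ht => by
    filter_upwards [Iio_mem_nhds ht] with s hs using hlt s hs
  refine ⟨x, ⟨fun t _ => ContinuousAt.continuousWithinAt ?_, ?_, ?_⟩, ?_⟩
  · rcases lt_trichotomy t T with ht | rfl | ht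
    · exact (hfd t ht).continuousAt.congr (hev t ht).symm
    · refine continuousAt_iff_continuous_left'_right'.2 ⟨?_, ?_⟩
      · rw [ContinuousWithinAt, hge t le_rfl]
        refine ((tendsto_exp_neg_smul_apply hc hL hz u).comp
          (tendsto_intrinsicTime (ρ₁ := ρ₁) hρ₂ hκ t)).congr' ?_
        filter_upwards [self_mem_nhdsWithin] with s hs using (hlt s hs).symm
      · rw [ContinuousWithinAt, hge t le_rfl]
        refine tendsto_const_nhds.congr' ?_
        filter_upwards [self_mem_nhdsWithin] with s hs using (hge s (le_of_lt hs)).symm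
    · refine continuousAt_const.congr (f := fun _ => z) ?_
      filter_upwards [Ioi_mem_nhds ht] with s hs using (hge s (le_of_lt hs)).symm
  · intro t ht k
    rw [control_eq, hlt t ht.2]
    exact (hasDerivAt_pi.1 ((hfd t ht.2).congr_of_eventuallyEq (hev t ht.2)) k).hasDerivWithinAt
  · intro t ht k
    rw [control_eq, hge t ht, hz, Pi.zero_apply, mul_zero, neg_zero]
    exact (hasDerivWithinAt_const t _ (z k)).congr (fun s hs => by rw [hge s hs]) (by rw [hge t ht])
  · rw [hlt 0 hT, hf]
    simp [intrinsicTime_zero]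

theorem IsTrajectory.prescribedTimeBipartiteContainment (hρ₂ : 0 < ρ₂) (hκ : 0 < κ) (hT : 0 < T)
    {x : ℝ → V → ℝ} (hx : G.IsTrajectory ρ₁ ρ₂ κ T x) :
    G.PrescribedTimeBipartiteContainment T x := by
  obtain ⟨c, hc, hL⟩ := G.exists_norm_smul_one_sub_laplacianCLM_le
  obtain ⟨z, u, hz, hx0⟩ := exists_ker_sub_mem_range hc hL (x 0)
  have hrest : ∀ t ≥ T, x t = z := fun t ht => hx.eq_of_ge hρ₂ hκ hT hz hx0 ht
  have hlim : Tendsto x (𝓝 T) (𝓝 z) := hx.tendsto hT (hrest T le_rfl)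
  refine ⟨fun C hC hb => ?_, fun C hC hb => ?_, fun l hl => ⟨?_, fun t ht => ?_⟩⟩
  · obtain ⟨k₀, hk₀⟩ := hC.nonempty
    have : Nonempty C := ⟨⟨k₀, hk₀⟩⟩
    have hzC : (G.induce C).laplacianCLM (fun k : C => z k) = 0 := by
      rw [hC.laplacianCLM_induce, hz]
      rfl
    have habs : ∀ k ∈ C, |z k| = |z k₀| := fun k hk =>
      hC.stronglyConnected.abs_eq hzC ⟨k, hk⟩ ⟨k₀, hk₀⟩
    refine ⟨hb.range_laplacian_ne_top, |z k₀|, abs_nonneg _, fun k hk => ⟨?_, fun t ht => ?_⟩, ?_⟩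
    · rw [← habs k hk]
      exact (tendsto_pi_nhds.1 hlim k).abs
    · rw [hrest t ht]
      exact habs k hk
    -- the decomposition of `x 0` restricts to the one for the Laplacian of the component
    · have hx0C : (fun k : C => x 0 k)
          = (fun k : C => z k) + (G.induce C).laplacianCLM (fun k : C => u k) := by
        rw [hC.laplacianCLM_induce, hx0]
        rfl
      obtain ⟨cC, hcC, hLC⟩ := (G.induce C).exists_norm_smul_one_sub_laplacianCLM_le
      rw [← not_iff_not, not_not, abs_pos, not_not]
      constructor
      · intro h0
        refine ⟨fun k : C => u k, ?_⟩
        rw [hx0C]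
        have : (fun k : C => z k) = 0 := by
          ext k
          rw [Pi.zero_apply, ← abs_eq_zero, habs k k.2, h0, abs_zero]
        rw [this, zero_add]
        rfl
      · rintro ⟨v, hv⟩
        have hv' : (G.induce C).laplacianCLM v
            = (fun k : C => z k) + (G.induce C).laplacianCLM (fun k : C => u k) := hv.trans hx0C
        have hzv : (fun k : C => z k) = (G.induce C).laplacianCLM (v - fun k : C => u k) := by
          rw [map_sub, hv', add_sub_cancel_right]
        rw [hzv] at hzC
        have h0 := apply_eq_zero_of_apply_apply_eq_zero hcC hLC hzC
        rw [← hzv] at h0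
        exact congrFun h0 ⟨k₀, hk₀⟩
  · exact prescribedTimeStability_of_tendsto hlim hrest fun k hk =>
      hC.eq_zero_of_not_balanced hb hz hk
  · have : Nonempty V := ⟨l⟩
    exact ⟨G.leaderMax z - |z l|, sub_nonneg.2 (abs_le_leaderMax hz l),
      ((continuous_leaderMax.tendsto z).comp hlim).sub (tendsto_pi_nhds.1 hlim l).abs⟩
  · rw [hrest t ht]
    exact abs_le.1 (abs_le_leaderMax hz l)

theorem IsTrajectory.prescribedTimeStability (hρ₂ : 0 < ρ₂) (hκ : 0 < κ) (hT : 0 < T)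
    (hG : ∀ C : Finset V, G.IsClosedStrongComponent C → ¬ (G.induce C).StructurallyBalanced)
    {x : ℝ → V → ℝ} (hx : G.IsTrajectory ρ₁ ρ₂ κ T x) :
    PrescribedTimeStability Set.univ T x := by
  obtain ⟨c, hc, hL⟩ := G.exists_norm_smul_one_sub_laplacianCLM_le
  obtain ⟨z, u, hz, hx0⟩ := exists_ker_sub_mem_range hc hL (x 0)
  have hrest : ∀ t ≥ T, x t = z := fun t ht => hx.eq_of_ge hρ₂ hκ hT hz hx0 ht
  refine prescribedTimeStability_of_tendsto (hx.tendsto hT (hrest T le_rfl)) hrest fun k _ => ?_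
  have : Nonempty V := ⟨k⟩
  obtain ⟨C, hC, c, hcC, hmax⟩ := exists_isClosedStrongComponent_abs_le hz
  rw [← abs_nonpos_iff, ← abs_zero, ← hC.eq_zero_of_not_balanced (hG C hC) hz hcC]
  exact hmax k

end Trajectories

end SignedDigraph

theorem theorem3 (N : ℕ) (hN : 2 ≤ N) (G : SignedDigraph (Fin N)) (hG : G.WeaklyConnected)
    (ρ₁ ρ₂ κ T₁ : ℝ) (hρ₁ : 0 < ρ₁) (hρ₂ : 0 < ρ₂) (hκ : 0 < κ) (hT₁ : 0 < T₁) :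
    ((∃ C : Finset (Fin N), G.IsClosedStrongComponent C ∧ (G.induce C).StructurallyBalanced) →
      G.Achieves ρ₁ ρ₂ κ T₁ (fun x => G.PrescribedTimeBipartiteContainment T₁ x)) ∧
    ((∀ C : Finset (Fin N), G.IsClosedStrongComponent C →
        ¬ (G.induce C).StructurallyBalanced) →
      G.Achieves ρ₁ ρ₂ κ T₁ (fun x => PrescribedTimeStability Set.univ T₁ x)) := by
  refine ⟨fun _ => ⟨fun x₀ => SignedDigraph.exists_isTrajectory hρ₂ hκ hT₁ x₀,
    fun x hx => hx.prescribedTimeBipartiteContainment hρ₂ hκ hT₁⟩,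
    fun h => ⟨fun x₀ => SignedDigraph.exists_isTrajectory hρ₂ hκ hT₁ x₀,
      fun x hx => hx.prescribedTimeStability hρ₂ hκ hT₁ h⟩⟩
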